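/- **Theorem.** Let $d\ge 1$ be an integer and let $(M_n)_{n\ge 0}$ be a sequence of positive real numbers with $M_0=1$ that is log-convex, i.e. $M_n^2\le M_{n-1}M_{n+1}$ for all $n\ge 1$. Let $C\{M_n\}$ be the set of all infinitely differentiable functions $f:\mathbb{R}\to\mathbb{R}$ for which there are constants $\beta,B>0$ (depending on $f$) with $\sup_{x\in\mathbb{R}}|f^{(n)}(x)|\le \beta B^n M_n$ for all $n\ge 0$. Call $C\{M_n\}$ quasi-analytic if every $f\in C\{M_n\}$ with $f^{(n)}(0)=0$ for all $n\ge 0$ is identically zero. Then the following are equivalent. 1. The class $C\{M_n\}$ is quasi-analytic. 2. Whenever $\mu,\nu$ are non-negative Borel measures on $\mathbb{R}^d$ with finite moments of all orders (i.e. $x^\alpha=x_1^{\alpha_1}\cdots x_d^{\alpha_d}$ is integrable with respect to $\mu$ and to $\nu$ for every $\alpha\in\mathbb{N}_0^d$) such that $\int_{\mathbb{R}^d} x^\alpha\,\mu(dx)=\int_{\mathbb{R}^d} x^\alpha\,\nu(dx)$ for all $\alpha\in\mathbb{N}_0^d$, and such that there is a constant $c>0$ with $$\max\left(\int_{\mathbb{R}^d}\|x\|^{2n}\,\mu(dx),\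 \int_{\mathbb{R}^d}\|x\|^{2n}\,\nu(dx)\right)\le c\,M_{2n}\quad\text{for all integers } n\ge 1,$$ where $\|\cdot\|$ is the Euclidean norm, then $\mu=\nu$. -/

import Mathlib

open MeasureTheory
open scoped ContDiff

namespace MomentProblem

/-- A sequence `(M_n)_{n ≥ 0}` is log-convex if `M_n ^ 2 ≤ M_{n-1} * M_{n+1}` for all `n ≥ 1`. -/
def LogConvex (M : ℕ → ℝ) : Prop :=
  ∀ n : ℕ, 1 ≤ n → M n ^ 2 ≤ M (n - 1) * M (n + 1)

/-- The class `C{M_n}`: all smooth `f : ℝ → ℝ` for which there are positive constants `β`, `B` with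
`sup_x |f^(n)(x)| ≤ β * B ^ n * M_n` for every `n ≥ 0`. -/
def derivClass (M : ℕ → ℝ) : Set (ℝ → ℝ) :=
  {f | ContDiff ℝ ∞ f ∧
    ∃ β B : ℝ, 0 < β ∧ 0 < B ∧ ∀ (n : ℕ) (x : ℝ), |iteratedDeriv n f x| ≤ β * B ^ n * M n}

/-- The class `C{M_n}` is quasi-analytic if every member all of whose derivatives (of order `≥ 0`)
vanish at the origin is identically zero. -/
def IsQuasiAnalytic (M : ℕ → ℝ) : Prop :=
  ∀ f ∈ derivClass M, (∀ n : ℕ, iteratedDeriv n f 0 = 0) → ∀ x : ℝ, f x = 0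

/-- The monomial `x ^ α = x_1 ^ α_1 * ⋯ * x_d ^ α_d` on `ℝ^d`. -/
def monomial {d : ℕ} (α : Fin d → ℕ) (x : EuclideanSpace ℝ (Fin d)) : ℝ :=
  ∏ j, x j ^ α j

/-- The non-negative Borel measures on `ℝ^d` with finite moments of all orders. The multi-index
`α = 0` makes such a measure finite. -/
def finiteMomentMeasures (d : ℕ) : Set (Measure (EuclideanSpace ℝ (Fin d))) :=
  {μ | ∀ α : Fin d → ℕ, Integrable (monomial α) μ}

/-- The moment of `μ` of multi-order `α`. -/
noncomputable def moment {d : ℕ} (μ : Measure (EuclideanSpace ℝ (Fin d))) (α : Fin d → ℕ) : ℝ :=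
  ∫ x, monomial α x ∂μ

end MomentProblem

/-! ### Divergence implies quasi-analyticity (Bang's argument) -/

namespace MomentProblem

open Real Filter Set Topology

/-! Both statements are equivalent to the divergence of `∑ M n / M (n + 1)`.

If the series diverges, Bang's propagation argument (`isQuasiAnalytic_of_not_summable`) makes the
class quasi-analytic. For determinacy only even moments are controlled, and Cauchy–Schwarz bounds
the odd ones by `√(M (2k) * M (2k+2))`, which may exceed `M (2k+1)`. So `M` is replaced by
`evenMajorant M`, which dominates all absolute moments and still has a divergent series. The
characteristic functions of the one-dimensional projections then lie in a quasi-analytic class and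
agree to infinite order at `0`, hence coincide.

If the series converges, put `a k = M k / M (k + 1)`. The product of the `sinc (a k * x)` decays
like `M n / |x| ^ n` for every `n`; multiplied by a Schwartz function whose Fourier transform
vanishes on a large interval, it gives a density `g` with all moments zero (`exists_density`). Its
positive and negative parts are distinct measures with equal moments. Placed on a coordinate axis
they refute determinacy; by determinacy on the line they also refute quasi-analyticity, so the
converse half of Denjoy–Carleman needs no separate construction. -/

lemma hasDerivAt_iteratedDeriv {f : ℝ → ℝ} (hf : ContDiff ℝ ∞ f) (j : ℕ) (x : ℝ) :
    HasDerivAt (iteratedDeriv j f) (iteratedDeriv (j + 1) f x) x := by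
  rw [iteratedDeriv_succ]
  exact ((hf.differentiable_iteratedDeriv j (by exact_mod_cast WithTop.coe_lt_top _)) x).hasDerivAt

/-- Growth of the weighted derivatives `exp (n - j) * |f^(j)| / N_j`, `j ≤ n`, in Bang's proof
of the Denjoy–Carleman theorem. -/
lemma abs_iteratedDeriv_add_le {f : ℝ → ℝ} (hf : ContDiff ℝ ∞ f) {N : ℕ → ℝ} {n : ℕ} {l : ℝ}
    (hl : 0 < l) (hN : ∀ j < n, N (j + 1) ≤ l * N j)
    (hb : ∀ x, |iteratedDeriv n f x| ≤ N n) {y : ℝ}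
    (hy : ∀ j ≤ n, |iteratedDeriv j f y| ≤ exp (j - n) * N j) {j : ℕ} (hj : j ≤ n) :
    ∀ x, y ≤ x → |iteratedDeriv j f x| ≤ exp (j - n) * N j * exp (exp 1 * l * (x - y)) := by
  induction hj using Nat.decreasingInduction with
  | self =>
    intro x hx
    have h0 : 0 ≤ N n := (abs_nonneg _).trans (hb x)
    have h1 : 1 ≤ exp (exp 1 * l * (x - y)) :=
      one_le_exp (mul_nonneg (by positivity) (sub_nonneg.2 hx))
    rw [sub_self, exp_zero, one_mul]
    exact (hb x).trans (le_mul_of_one_le_right h0 h1)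
  | of_succ k hk ih =>
    intro x hx
    have hB : ∀ z, HasDerivAt (fun z => exp (k - n) * N k * exp (exp 1 * l * (z - y)))
        (exp (k - n) * N k * (exp (exp 1 * l * (z - y)) * (exp 1 * l))) z := fun z => by
      have := (((hasDerivAt_id z).sub_const y).const_mul (exp 1 * l)).exp.const_mul
        (exp (k - n) * N k)
      simpa using this
    -- The rate `exp 1 * l` is chosen so that the bound for order `k + 1` is at most the derivative
    -- of the bound for order `k`: `l` pays for `N (k + 1) / N k`, and `exp 1` for the change of
    -- weight.
    refine image_norm_le_of_norm_deriv_right_le_deriv_boundary (a := y) (b := x)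
      (f' := iteratedDeriv (k + 1) f)
      (fun z _ => (hasDerivAt_iteratedDeriv hf k z).continuousAt.continuousWithinAt)
      (fun z _ => (hasDerivAt_iteratedDeriv hf k z).hasDerivWithinAt) ?_ hB ?_ ⟨hx, le_rfl⟩
    · simpa using hy k hk.le
    · intro z hz
      refine (ih z hz.1).trans ?_
      have h2 : exp ((k + 1 : ℕ) - n : ℝ) = exp (k - n) * exp 1 := by
        rw [← exp_add]; push_cast; ring_nf
      rw [h2]
      calc exp (k - n) * exp 1 * N (k + 1) * exp (exp 1 * l * (z - y))
          ≤ exp (k - n) * exp 1 * (l * N k) * exp (exp 1 * l * (z - y)) := by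
            gcongr; exact hN k hk
        _ = _ := by ring

/-- At `0` the bound holds at every level `a`. Moving right by `(exp 1 * L a)⁻¹` costs at most one
factor `exp 1`, which lowers the level from `a + 1` to `a`; orders `j > a + 1` are covered by the
global bound. Hence level `a` survives over a distance equal to a sum of such steps. -/
lemma abs_iteratedDeriv_le_exp_of_sum {f : ℝ → ℝ} (hf : ContDiff ℝ ∞ f) {N L : ℕ → ℝ}
    (hL : ∀ n, 0 < L n) (hmono : Monotone L) (hN : ∀ n, N (n + 1) ≤ L n * N n)
    (hNpos : ∀ n, 0 ≤ N n) (hb : ∀ n x, |iteratedDeriv n f x| ≤ N n)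
    (h0 : ∀ n, iteratedDeriv n f 0 = 0) (a m : ℕ) (x : ℝ) (hx : 0 ≤ x)
    (hxm : x ≤ ∑ i ∈ Finset.range m, (exp 1 * L (a + i))⁻¹) :
    ∀ j, |iteratedDeriv j f x| ≤ exp (j - a) * N j := by
  induction m generalizing a x with
  | zero =>
    have : x = 0 := le_antisymm (by simpa using hxm) hx
    subst this
    intro j
    rw [h0, abs_zero]
    exact mul_nonneg (exp_pos _).le (hNpos j)
  | succ m ih =>
    set h := (exp 1 * L a)⁻¹ with hh
    have hhpos : 0 < h := inv_pos.2 (mul_pos (exp_pos _) (hL a))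
    have key : ∀ y, 0 ≤ y → y ≤ x → x - y ≤ h →
        (∀ j, |iteratedDeriv j f y| ≤ exp (j - (a + 1 : ℕ)) * N j) →
        ∀ j, |iteratedDeriv j f x| ≤ exp (j - a) * N j := by
      intro y hy hyx hxy hyj j
      rcases le_or_gt j (a + 1) with hj | hj
      · refine (abs_iteratedDeriv_add_le hf (hL a) (n := a + 1) (fun i hi => ?_) (hb _)
          (fun i _ => hyj i) hj x hyx).trans ?_
        · exact (hN i).trans (mul_le_mul_of_nonneg_right (hmono (Nat.lt_succ_iff.1 hi)) (hNpos i))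
        · have h1 : exp 1 * L a * (x - y) ≤ 1 := by
            have := mul_le_mul_of_nonneg_left hxy (mul_pos (exp_pos 1) (hL a)).le
            rwa [hh, mul_inv_cancel₀ (mul_pos (exp_pos 1) (hL a)).ne'] at this
          have h2 : exp (j - a : ℝ) = exp (j - (a + 1 : ℕ)) * exp 1 := by
            rw [← exp_add]; push_cast; ring_nf
          rw [h2, mul_right_comm]
          gcongr
          exact hNpos j
      · refine (hb j x).trans (le_mul_of_one_le_left (hNpos j) (one_le_exp ?_))
        have : (a : ℝ) + 1 < j := by exact_mod_cast hj
        linarith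
    rw [Finset.sum_range_succ'] at hxm
    rcases le_total x h with hxh | hxh
    · exact key 0 le_rfl hx (by simpa using hxh) (fun j => by
        rw [h0, abs_zero]; exact mul_nonneg (exp_pos _).le (hNpos j))
    · refine key (x - h) (by linarith) (by linarith) (by linarith) ?_
      refine ih (a + 1) (x - h) (by linarith) ?_
      have : ∑ i ∈ Finset.range m, (exp 1 * L (a + (i + 1)))⁻¹ =
          ∑ i ∈ Finset.range m, (exp 1 * L (a + 1 + i))⁻¹ :=
        Finset.sum_congr rfl fun i _ => by rw [add_right_comm, add_assoc]
      rw [this, add_zero, ← hh] at hxm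
      linarith

/-- Divergence lets every level `a` reach the given `x`, so `|f x| ≤ exp (-a) * N 0` for all `a`. -/
lemma eq_zero_of_not_summable_of_nonneg {f : ℝ → ℝ} (hf : ContDiff ℝ ∞ f) {N L : ℕ → ℝ}
    (hL : ∀ n, 0 < L n) (hmono : Monotone L) (hN : ∀ n, N (n + 1) ≤ L n * N n)
    (hNpos : ∀ n, 0 ≤ N n) (hb : ∀ n x, |iteratedDeriv n f x| ≤ N n)
    (h0 : ∀ n, iteratedDeriv n f 0 = 0) (hS : ¬ Summable fun n => (L n)⁻¹) {x : ℝ} (hx : 0 ≤ x) :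
    f x = 0 := by
  have key : ∀ a : ℕ, |f x| ≤ exp (-a) * N 0 := by
    intro a
    have hS' : ¬ Summable fun i => (exp 1 * L (a + i))⁻¹ := by
      intro h
      apply hS
      rw [← summable_nat_add_iff a]
      refine (h.mul_left (exp 1)).congr fun i => ?_
      rw [mul_inv, ← mul_assoc, mul_inv_cancel₀ (exp_pos 1).ne', one_mul, add_comm]
    have ht := (not_summable_iff_tendsto_nat_atTop_of_nonneg
      (fun i => inv_nonneg.2 (mul_pos (exp_pos 1) (hL (a + i))).le)).1 hS'
    obtain ⟨m, hm⟩ := (ht.eventually_ge_atTop x).exists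
    simpa using abs_iteratedDeriv_le_exp_of_sum hf hL hmono hN hNpos hb h0 a m x hx hm 0
  have hlim : Tendsto (fun a : ℕ => exp (-a) * N 0) atTop (𝓝 0) := by
    have := (tendsto_exp_neg_atTop_nhds_zero.comp tendsto_natCast_atTop_atTop).mul_const (N 0)
    simpa using this
  exact abs_eq_zero.1 (le_antisymm (ge_of_tendsto' hlim key) (abs_nonneg _))

/-- The Denjoy–Carleman theorem, sufficiency of Carleman's condition. -/
theorem isQuasiAnalytic_of_not_summable {N L : ℕ → ℝ} (hL : ∀ n, 0 < L n) (hmono : Monotone L)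
    (hN : ∀ n, N (n + 1) ≤ L n * N n) (hNpos : ∀ n, 0 ≤ N n)
    (hS : ¬ Summable fun n => (L n)⁻¹) : IsQuasiAnalytic N := by
  rintro f ⟨hf, β, B, hβ, hB, hb⟩ h0 x
  have main : ∀ g : ℝ → ℝ, ContDiff ℝ ∞ g → (∀ n x, |iteratedDeriv n g x| ≤ β * B ^ n * N n) →
      (∀ n, iteratedDeriv n g 0 = 0) → ∀ x, 0 ≤ x → g x = 0 := by
    intro g hg hgb hg0 x hx
    refine eq_zero_of_not_summable_of_nonneg hg (L := fun n => B * L n)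
      (N := fun n => β * B ^ n * N n) (fun n => mul_pos hB (hL n))
      (fun i j hij => mul_le_mul_of_nonneg_left (hmono hij) hB.le) (fun n => ?_)
      (fun n => mul_nonneg (by positivity) (hNpos n)) hgb hg0 ?_ hx
    · calc β * B ^ (n + 1) * N (n + 1) ≤ β * B ^ (n + 1) * (L n * N n) := by
            gcongr; exact hN n
        _ = _ := by ring
    · intro h
      refine hS ((h.mul_left B).congr fun n => ?_)
      rw [mul_inv, ← mul_assoc, mul_inv_cancel₀ hB.ne', one_mul]
  rcases le_total 0 x with hx | hx
  · exact main f hf hb h0 x hx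
  · have := main (fun z => f (-z)) (hf.comp contDiff_neg) (fun n z => ?_) (fun n => ?_) (-x)
      (neg_nonneg.2 hx)
    · simpa using this
    · rw [iteratedDeriv_comp_neg, smul_eq_mul, abs_mul, abs_pow, abs_neg, abs_one, one_pow, one_mul]
      exact hb n _
    · rw [iteratedDeriv_comp_neg, neg_zero, h0, smul_zero]

end MomentProblem

/-! ### Characteristic functions and determinacy on the line -/

namespace MomentProblem

open Complex

lemma memLp_id_of_integrable_abs_pow {μ : Measure ℝ} [IsFiniteMeasure μ]
    (hμ : ∀ n : ℕ, Integrable (fun x => |x| ^ n) μ) (n : ℕ) : MemLp id n μ := by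
  rcases Nat.eq_zero_or_pos n with rfl | hn
  · simpa using aestronglyMeasurable_id
  · refine (integrable_norm_rpow_iff aestronglyMeasurable_id (by simpa using hn.ne') (by simp)).1 ?_
    simpa using hμ n

lemma norm_iteratedDeriv_charFun_le {μ : Measure ℝ} [IsFiniteMeasure μ]
    (hμ : ∀ n : ℕ, Integrable (fun x => |x| ^ n) μ) (n : ℕ) (t : ℝ) :
    ‖iteratedDeriv n (charFun μ) t‖ ≤ ∫ x, |x| ^ n ∂μ := by
  rw [iteratedDeriv_charFun (memLp_id_of_integrable_abs_pow hμ n), norm_mul, norm_pow, norm_I,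
    one_pow, one_mul]
  refine (norm_integral_le_integral_norm _).trans_eq (integral_congr_ae (.of_forall fun x => ?_))
  have : (t : ℂ) * x * I = ((t * x : ℝ) : ℂ) * I := by push_cast; ring
  simp only [norm_mul, norm_pow, this, norm_exp_ofReal_mul_I, mul_one, norm_real, Real.norm_eq_abs]

lemma iteratedDeriv_clm_comp {E F : Type*} [NormedAddCommGroup E] [NormedSpace ℝ E]
    [NormedAddCommGroup F] [NormedSpace ℝ F] (L : E →L[ℝ] F) {f : ℝ → E} (hf : ContDiff ℝ ∞ f)
    (n : ℕ) (x : ℝ) : iteratedDeriv n (fun y => L (f y)) x = L (iteratedDeriv n f x) := by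
  have := L.iteratedFDeriv_comp_left (f := f) (x := x) hf.contDiffAt (i := n)
    (by exact_mod_cast le_top)
  simp only [iteratedDeriv_eq_iteratedFDeriv]
  change iteratedFDeriv ℝ n (L ∘ f) x _ = _
  rw [this]
  rfl

/-- Determinacy on the line in a quasi-analytic class. -/
theorem eq_of_moments_eq_of_isQuasiAnalytic {N : ℕ → ℝ} (hQ : IsQuasiAnalytic N)
    {μ ν : Measure ℝ} [IsFiniteMeasure μ] [IsFiniteMeasure ν]
    (hμ : ∀ n : ℕ, Integrable (fun x => |x| ^ n) μ) (hν : ∀ n : ℕ, Integrable (fun x => |x| ^ n) ν)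
    (heq : ∀ n : ℕ, ∫ x, x ^ n ∂μ = ∫ x, x ^ n ∂ν) {c B : ℝ} (hc : 0 < c) (hB : 0 < B)
    (hμN : ∀ n : ℕ, ∫ x, |x| ^ n ∂μ ≤ c * B ^ n * N n)
    (hνN : ∀ n : ℕ, ∫ x, |x| ^ n ∂ν ≤ c * B ^ n * N n) : μ = ν := by
  have cμ : ContDiff ℝ ∞ (charFun μ) :=
    contDiff_charFun' (n := ⊤) (memLp_id_of_integrable_abs_pow hμ)
  have cν : ContDiff ℝ ∞ (charFun ν) :=
    contDiff_charFun' (n := ⊤) (memLp_id_of_integrable_abs_pow hν)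
  have hsub : ∀ n t, iteratedDeriv n (fun t => charFun μ t - charFun ν t) t =
      iteratedDeriv n (charFun μ) t - iteratedDeriv n (charFun ν) t := fun n t =>
    iteratedDeriv_fun_sub (cμ.contDiffAt.of_le (by exact_mod_cast le_top))
      (cν.contDiffAt.of_le (by exact_mod_cast le_top))
  have hC := cμ.sub cν
  -- The class consists of real functions, so the real and imaginary parts are treated separately.
  -- Derivatives at `0` are moments up to powers of `i`, hence they cancel.
  have key : ∀ L : ℂ →L[ℝ] ℝ, (∀ z, |L z| ≤ ‖z‖) → ∀ t, L (charFun μ t - charFun ν t) = 0 := by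
    intro L hL
    refine hQ _ ⟨L.contDiff.comp hC, 2 * c, B, by positivity, hB, fun n t => ?_⟩ fun n => ?_
    · rw [iteratedDeriv_clm_comp L hC, hsub]
      refine (hL _).trans ((norm_sub_le _ _).trans ?_)
      have h1 := (norm_iteratedDeriv_charFun_le hμ n t).trans (hμN n)
      have h2 := (norm_iteratedDeriv_charFun_le hν n t).trans (hνN n)
      linarith
    · rw [iteratedDeriv_clm_comp L hC, hsub,
        iteratedDeriv_charFun_zero (memLp_id_of_integrable_abs_pow hμ n),
        iteratedDeriv_charFun_zero (memLp_id_of_integrable_abs_pow hν n)]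
      simp [heq]
  refine Measure.ext_of_charFun (funext fun t => ?_)
  refine sub_eq_zero.1 (Complex.ext ?_ ?_)
  · exact key reCLM abs_re_le_norm t
  · exact key imCLM abs_im_le_norm t

end MomentProblem

/-! ### Sinc factors and the Fourier transform -/

namespace MomentProblem

open Complex Real Filter Topology
open scoped FourierTransform SchwartzMap

lemma sinc_eq_integral_exp (y : ℝ) :
    (sinc y : ℂ) = 2⁻¹ * ∫ u in (-1 : ℝ)..1, cexp (I * ((u * y : ℝ) : ℂ)) := by
  rcases eq_or_ne y 0 with rfl | hy
  · norm_num
  · have hy' : (y : ℂ) ≠ 0 := by exact_mod_cast hy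
    have h1 : ∀ u : ℝ, I * ((u * y : ℝ) : ℂ) = I * y * u := fun u => by push_cast; ring
    simp_rw [h1]
    rw [integral_exp_mul_complex (mul_ne_zero I_ne_zero hy'), sinc_of_ne_zero hy]
    push_cast
    rw [Complex.sin]
    have e1 : I * (y : ℂ) * 1 = y * I := by ring
    have e2 : I * (y : ℂ) * -1 = -y * I := by ring
    rw [e1, e2]
    field_simp
    rw [I_sq]
    ring

lemma abs_sinc_sub_one_le (y : ℝ) : |sinc y - 1| ≤ |y| := by
  have h : ((sinc y - 1 : ℝ) : ℂ) =
      2⁻¹ * ∫ u in (-1 : ℝ)..1, (cexp (I * ((u * y : ℝ) : ℂ)) - 1) := by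
    rw [intervalIntegral.integral_sub (Continuous.intervalIntegrable (by fun_prop) _ _)
      (by simp), mul_sub, ← sinc_eq_integral_exp]
    norm_num
  have h2 : ‖∫ u in (-1 : ℝ)..1, (cexp (I * ((u * y : ℝ) : ℂ)) - 1)‖ ≤ |y| * |1 - (-1)| := by
    refine intervalIntegral.norm_integral_le_of_norm_le_const fun u hu => ?_
    refine norm_exp_I_mul_ofReal_sub_one_le.trans ?_
    rw [Real.norm_eq_abs, abs_mul]
    rw [Set.uIoc_of_le (by norm_num)] at hu
    exact mul_le_of_le_one_left (abs_nonneg _) (abs_le.2 ⟨hu.1.le, hu.2⟩)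
  rw [← Real.norm_eq_abs, ← norm_real, h, norm_mul]
  norm_num at h2 ⊢
  linarith

lemma abs_mul_abs_sinc_le {a : ℝ} (ha : 0 < a) (x : ℝ) : |x| * |sinc (a * x)| ≤ a⁻¹ := by
  rcases eq_or_ne x 0 with rfl | hx
  · simpa using ha.le
  · rw [sinc_of_ne_zero (by positivity), abs_div, abs_mul, abs_of_pos ha]
    have := abs_sin_le_one (a * x)
    have hx' := abs_pos.2 hx
    rw [show |x| * (|Real.sin (a * x)| / (a * |x|)) = |Real.sin (a * x)| / a by field_simp, ← one_div]
    gcongr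

/-- Multiplication by `sinc (a x)` averages the Fourier transform over shifts of size at most
`a / (2 π) ≤ a`. -/
lemma fourier_sinc_mul_eq_zero {Φ : ℝ → ℂ} (hΦ : Integrable Φ) {a r : ℝ} (ha : 0 ≤ a)
    (h : ∀ s, |s| < r → 𝓕 Φ s = 0) {s : ℝ} (hs : |s| < r - a) :
    𝓕 (fun x => (sinc (a * x) : ℂ) * Φ x) s = 0 := by
  have hsplit : ∀ x u : ℝ, cexp (↑(-2 * π * x * s) * I) * (cexp (I * ((u * (a * x) : ℝ) : ℂ)) * Φ x)
      = cexp (↑(-2 * π * x * (s - u * a / (2 * π))) * I) * Φ x := by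
    intro x u
    rw [← mul_assoc, ← Complex.exp_add]
    congr 2
    have : (π : ℂ) ≠ 0 := by exact_mod_cast pi_ne_zero
    push_cast
    field_simp
    ring
  have hint : Integrable (Function.uncurry fun (u x : ℝ) =>
      cexp (↑(-2 * π * x * (s - u * a / (2 * π))) * I) * Φ x)
      ((volume.restrict (Set.uIoc (-1) 1)).prod volume) := by
    have h1 : Integrable (fun p : ℝ × ℝ => (1 : ℂ) * Φ p.2)
        ((volume.restrict (Set.uIoc (-1 : ℝ) 1)).prod volume) :=
      Integrable.mul_prod (f := fun _ : ℝ => (1 : ℂ)) (by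
        rw [Set.uIoc_of_le (by norm_num)]; exact integrable_const _) hΦ
    refine h1.mono ?_ (.of_forall fun p => ?_)
    · refine AEStronglyMeasurable.mul (Continuous.aestronglyMeasurable (by fun_prop)) ?_
      simpa using h1.aestronglyMeasurable
    · simp only [Function.uncurry, norm_mul, norm_exp_ofReal_mul_I, norm_one]
      exact le_rfl
  rw [fourier_real_eq_integral_exp_smul]
  have e : ∀ x : ℝ, cexp (↑(-2 * π * x * s) * I) • ((sinc (a * x) : ℂ) * Φ x) =
      2⁻¹ * ∫ u in (-1 : ℝ)..1, cexp (↑(-2 * π * x * (s - u * a / (2 * π))) * I) * Φ x := by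
    intro x
    rw [sinc_eq_integral_exp, smul_eq_mul]
    simp_rw [← hsplit]
    rw [intervalIntegral.integral_const_mul, intervalIntegral.integral_mul_const]
    ring
  simp_rw [e]
  rw [integral_const_mul, ← intervalIntegral_integral_swap hint]
  have z : ∀ u ∈ Set.uIcc (-1 : ℝ) 1,
      ∫ x : ℝ, cexp (↑(-2 * π * x * (s - u * a / (2 * π))) * I) * Φ x = 0 := by
    intro u hu
    rw [Set.uIcc_of_le (by norm_num)] at hu
    have := h (s - u * a / (2 * π)) ?_
    · rw [fourier_real_eq_integral_exp_smul] at this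
      exact this
    · have h2 : |u * a / (2 * π)| ≤ a := by
        rw [abs_div, abs_mul, abs_of_nonneg ha, abs_of_pos (by positivity : 0 < 2 * π)]
        have hu' : |u| ≤ 1 := abs_le.2 hu
        have hπ := pi_gt_three
        refine div_le_of_le_mul₀ (by positivity) ha ?_
        nlinarith
      linarith [abs_sub s (u * a / (2 * π))]
  rw [intervalIntegral.integral_congr (g := fun _ => 0) z]
  simp

/-- Take the inverse Fourier transform of a bump of radius `1` centred at `R + 1`; its value at `0`
is the integral of the bump. -/
lemma exists_schwartzMap_fourier_eq_zero (R : ℝ) :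
    ∃ ψ : 𝓢(ℝ, ℂ), (∀ s, |s| < R → 𝓕 (ψ : ℝ → ℂ) s = 0) ∧ 0 < (ψ 0).re := by
  let b : ContDiffBump (R + 1) := ⟨1 / 2, 1, by norm_num, by norm_num⟩
  have hsm : ContDiff ℝ ∞ (fun x => ((b x : ℝ) : ℂ)) := ofRealCLM.contDiff.comp b.contDiff
  have hcs : HasCompactSupport (fun x => ((b x : ℝ) : ℂ)) :=
    b.hasCompactSupport.comp_left (g := ((↑) : ℝ → ℂ)) rfl
  let η : 𝓢(ℝ, ℂ) := hcs.toSchwartzMap hsm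
  have hη : ∀ x, η x = (b x : ℂ) := fun x => rfl
  refine ⟨𝓕⁻ η, fun s hs => ?_, ?_⟩
  · rw [← SchwartzMap.fourier_coe, FourierTransform.fourier_fourierInv_eq, hη]
    have : b s = 0 := b.zero_of_le_dist (by
      rw [Real.dist_eq, abs_sub_comm]
      exact le_trans (by linarith [(abs_lt.1 hs).2]) (le_abs_self _))
    simp [this]
  · rw [SchwartzMap.fourierInv_coe, fourierInv_eq']
    simp only [inner_zero_right, mul_zero, ofReal_zero, zero_mul, Complex.exp_zero, one_smul, hη]
    rw [integral_complex_ofReal, ofReal_re]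
    exact b.integral_pos

end MomentProblem

/-! ### Infinite sinc products and indeterminate pairs -/

namespace MomentProblem

open Complex Real Filter Topology
open scoped FourierTransform SchwartzMap

/-- Each sinc factor shrinks the interval of vanishing by at most `a k` at each end. -/
lemma fourier_prod_sinc_mul_eq_zero {ψ : 𝓢(ℝ, ℂ)} {a : ℕ → ℝ} (ha : ∀ k, 0 < a k) {R : ℝ}
    (hψ : ∀ s, |s| < R → 𝓕 (ψ : ℝ → ℂ) s = 0) (m : ℕ) :
    ∀ s, |s| < R - ∑ k ∈ Finset.range m, a k →
      𝓕 (fun x => ((∏ k ∈ Finset.range m, sinc (a k * x) : ℝ) : ℂ) * ψ x) s = 0 := by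
  have hle : ∀ m x, |∏ k ∈ Finset.range m, sinc (a k * x)| ≤ 1 := fun m x => by
    rw [Finset.abs_prod]
    exact Finset.prod_le_one (fun _ _ => abs_nonneg _) fun _ _ => abs_sinc_le_one _
  induction m with
  | zero => simpa using hψ
  | succ m ih =>
    intro s hs
    have hint : Integrable (fun x =>
        ((∏ k ∈ Finset.range m, sinc (a k * x) : ℝ) : ℂ) * ψ x) := by
      refine ψ.integrable.mono (Continuous.aestronglyMeasurable ?_) (.of_forall fun x => ?_)
      · exact (continuous_ofReal.comp (continuous_finsetProd _ fun k _ => by fun_prop)).mul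
          ψ.continuous
      · rw [norm_mul, norm_real, Real.norm_eq_abs]
        exact mul_le_of_le_one_left (norm_nonneg _) (hle m x)
    rw [Finset.sum_range_succ] at hs
    have := fourier_sinc_mul_eq_zero hint (ha m).le ih (s := s) (by linarith)
    rw [← this]
    refine congrArg (fun F : ℝ → ℂ => 𝓕 F s) (funext fun x => ?_)
    rw [Finset.prod_range_succ]
    push_cast
    ring

/-- Each of the first `n` factors absorbs one power of `|x|`; the others are at most `1`. The bound
is uniform in `m`, so it passes to the infinite product. -/
lemma abs_pow_mul_abs_prod_sinc_le {a : ℕ → ℝ} (ha : ∀ k, 0 < a k) {n m : ℕ} (hnm : n ≤ m)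
    (x : ℝ) : |x| ^ n * |∏ k ∈ Finset.range m, sinc (a k * x)| ≤ ∏ k ∈ Finset.range n, (a k)⁻¹ := by
  rw [Finset.abs_prod, ← Finset.prod_range_mul_prod_Ico _ hnm, ← mul_assoc]
  refine (mul_le_of_le_one_right (by positivity)
    (Finset.prod_le_one (fun _ _ => abs_nonneg _) fun _ _ => abs_sinc_le_one _)).trans ?_
  have : |x| ^ n = ∏ _k ∈ Finset.range n, |x| := by simp
  rw [this, ← Finset.prod_mul_distrib]
  exact Finset.prod_le_prod (fun _ _ => by positivity) fun k _ => abs_mul_abs_sinc_le (ha k) x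

/-- A rapidly decaying nonzero density all of whose moments vanish. -/
lemma exists_density {a : ℕ → ℝ} (ha : ∀ k, 0 < a k) (hS : Summable a) :
    ∃ (g : ℝ → ℝ) (c : ℝ), Measurable g ∧ 0 < c ∧
      (∀ n : ℕ, Integrable fun x => |x| ^ n * |g x|) ∧
      (∀ n : ℕ, ∫ x, |x| ^ n * |g x| ≤ c * ∏ k ∈ Finset.range n, (a k)⁻¹) ∧
      (∀ n : ℕ, ∫ x, x ^ n * g x = 0) ∧ ∀ᶠ x in 𝓝 0, 0 < g x := by
  -- The extra `1` is what remains of the interval once all sinc factors have shrunk it.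
  obtain ⟨ψ, hψ, hψ0⟩ := exists_schwartzMap_fourier_eq_zero (∑' k, a k + 1)
  set P : ℕ → ℝ → ℝ := fun m x => ∏ k ∈ Finset.range m, sinc (a k * x) with hP
  set H : ℝ → ℝ := fun x => ∏' k, sinc (a k * x) with hH
  have hPc : ∀ m, Continuous (P m) := fun m => continuous_finsetProd _ fun k _ => by fun_prop
  have hlim : ∀ x, Tendsto (fun m => P m x) atTop (𝓝 (H x)) := by
    intro x
    have : Multipliable fun k => 1 + (sinc (a k * x) - 1) := by
      refine multipliable_one_add_of_summable (Summable.of_nonneg_of_le (fun _ => norm_nonneg _)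
        (fun k => ?_) (hS.mul_right |x|))
      rw [Real.norm_eq_abs]
      refine (abs_sinc_sub_one_le _).trans_eq ?_
      rw [abs_mul, abs_of_pos (ha k)]
    simp only [add_sub_cancel] at this
    exact this.hasProd.tendsto_prod_nat
  have hHm : Measurable H :=
    measurable_of_tendsto_metrizable (fun m => (hPc m).measurable) (tendsto_pi_nhds.2 hlim)
  have hHb : ∀ n x, |x| ^ n * |H x| ≤ ∏ k ∈ Finset.range n, (a k)⁻¹ := fun n x =>
    le_of_tendsto ((hlim x).abs.const_mul (|x| ^ n))
      ((eventually_ge_atTop n).mono fun m hm => abs_pow_mul_abs_prod_sinc_le ha hm x)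
  -- This lower bound keeps the infinite product positive near `0`, so that `g` does not vanish
  -- identically.
  have hH1 : ∀ x, 1 - (∑' k, a k) * |x| ≤ H x := by
    intro x
    refine ge_of_tendsto' (hlim x) fun m => ?_
    have h1 : ∀ m, |P m x - 1| ≤ (∑ k ∈ Finset.range m, a k) * |x| := by
      intro m
      induction m with
      | zero => simp [hP]
      | succ m ih =>
        have e : P (m + 1) x - 1 = P m x * (sinc (a m * x) - 1) + (P m x - 1) := by
          simp only [hP, Finset.prod_range_succ]; ring
        have hPle : |P m x| ≤ 1 := by
          simpa using abs_pow_mul_abs_prod_sinc_le ha (Nat.zero_le m) x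
        have hs := abs_sinc_sub_one_le (a m * x)
        rw [abs_mul, abs_of_pos (ha m)] at hs
        rw [e, Finset.sum_range_succ, add_mul]
        refine (abs_add_le _ _).trans ?_
        rw [abs_mul, add_comm]
        exact add_le_add ih ((mul_le_of_le_one_left (abs_nonneg _) hPle).trans hs)
    have h2 : (∑ k ∈ Finset.range m, a k) * |x| ≤ (∑' k, a k) * |x| :=
      mul_le_mul_of_nonneg_right (hS.sum_le_tsum _ fun k _ => (ha k).le) (abs_nonneg _)
    linarith [(abs_le.1 (h1 m)).1]
  have hkm : Measurable fun x => (H x : ℂ) * ψ x :=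
    (measurable_ofReal.comp hHm).mul ψ.continuous.measurable
  have hkb : ∀ n x, |x| ^ n * ‖(H x : ℂ) * ψ x‖ ≤ (∏ k ∈ Finset.range n, (a k)⁻¹) * ‖ψ x‖ := by
    intro n x
    rw [norm_mul, norm_real, Real.norm_eq_abs, ← mul_assoc]
    exact mul_le_mul_of_nonneg_right (hHb n x) (norm_nonneg _)
  have hki : ∀ n : ℕ, Integrable fun x : ℝ => (x : ℂ) ^ n * ((H x : ℂ) * ψ x) := by
    intro n
    refine (ψ.integrable.norm.const_mul (∏ k ∈ Finset.range n, (a k)⁻¹)).mono'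
      ((measurable_ofReal.pow_const n).mul hkm).aestronglyMeasurable (.of_forall fun x => ?_)
    rw [norm_mul, norm_pow, norm_real, Real.norm_eq_abs]
    exact hkb n x
  have hF : ∀ s, |s| < 1 → 𝓕 (fun x => (H x : ℂ) * ψ x) s = 0 := by
    intro s hs
    have hm : ∀ m, 𝓕 (fun x => ((P m x : ℝ) : ℂ) * ψ x) s = 0 := fun m =>
      fourier_prod_sinc_mul_eq_zero ha hψ m s (by
        have := hS.sum_le_tsum (Finset.range m) fun k _ => (ha k).le
        linarith)
    simp only [fourier_real_eq_integral_exp_smul] at hm ⊢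
    refine tendsto_nhds_unique (tendsto_integral_of_dominated_convergence (fun x => ‖ψ x‖)
      (F := fun m (x : ℝ) => cexp (↑(-2 * π * x * s) * I) • ((P m x : ℂ) * ψ x))
      (fun m => Continuous.aestronglyMeasurable ?_) ψ.integrable.norm
      (fun m => .of_forall fun x => ?_) (.of_forall fun x => ?_)) ?_
    · have := hPc m
      have := ψ.continuous
      fun_prop
    · rw [norm_smul, norm_exp_ofReal_mul_I, one_mul, norm_mul, norm_real, Real.norm_eq_abs]
      refine mul_le_of_le_one_left (norm_nonneg _) ?_
      simpa using abs_pow_mul_abs_prod_sinc_le ha (Nat.zero_le m) x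
    · exact (((continuous_ofReal.tendsto _).comp (hlim x)).mul_const _).const_smul _
    · simp only [hm]
      exact tendsto_const_nhds
  -- The Fourier transform vanishes near `0`, and its `n`-th derivative there is `(-2πi) ^ n` times
  -- the `n`-th moment.
  have hmom : ∀ n : ℕ, ∫ x : ℝ, (x : ℂ) ^ n * ((H x : ℂ) * ψ x) = 0 := by
    intro n
    have h1 : 𝓕 (fun x => (H x : ℂ) * ψ x) =ᶠ[𝓝 0] fun _ => 0 := by
      filter_upwards [Metric.ball_mem_nhds (0 : ℝ) one_pos] with s hs
      exact hF s (by simpa using hs)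
    have h2 := h1.iteratedDeriv_eq n
    rw [iteratedDeriv_fourier (N := ⊤) (fun n _ => ?_) le_top, fourier_real_eq_integral_exp_smul]
      at h2
    · simp only [mul_zero, ofReal_zero, zero_mul, Complex.exp_zero, smul_eq_mul, mul_pow,
        mul_assoc, integral_const_mul] at h2
      simpa [pi_ne_zero, I_ne_zero] using h2
    · refine (hki n).congr (.of_forall fun x => ?_)
      simp
  have hre : ∀ n (x : ℝ), ((x : ℂ) ^ n * ((H x : ℂ) * ψ x)).re = x ^ n * (H x * (ψ x).re) := by
    intro n x
    rw [← ofReal_pow, re_ofReal_mul, re_ofReal_mul]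
  have hle : ∀ n x, |x| ^ n * |H x * (ψ x).re| ≤ (∏ k ∈ Finset.range n, (a k)⁻¹) * ‖ψ x‖ := by
    intro n x
    refine le_trans (mul_le_mul_of_nonneg_left ?_ (by positivity)) (hkb n x)
    rw [← re_ofReal_mul]
    exact abs_re_le_norm _
  have hgm : Measurable fun x => H x * (ψ x).re :=
    hHm.mul (measurable_re.comp ψ.continuous.measurable)
  have hgi : ∀ n : ℕ, Integrable fun x => |x| ^ n * |H x * (ψ x).re| := fun n =>
    (ψ.integrable.norm.const_mul (∏ k ∈ Finset.range n, (a k)⁻¹)).mono'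
      ((measurable_id.abs.pow_const n).mul hgm.abs).aestronglyMeasurable (.of_forall fun x => by
        rw [Real.norm_eq_abs, abs_of_nonneg (by positivity)]
        exact hle n x)
  have hψ1 : 0 ≤ ∫ x, ‖ψ x‖ := integral_nonneg fun _ => norm_nonneg _
  refine ⟨fun x => H x * (ψ x).re, (∫ x, ‖ψ x‖) + 1, hgm, by linarith, hgi, fun n => ?_,
    fun n => ?_, ?_⟩
  · refine (integral_mono (hgi n) (ψ.integrable.norm.const_mul _) (hle n)).trans ?_
    rw [integral_const_mul, mul_comm]
    have : 0 ≤ ∏ k ∈ Finset.range n, (a k)⁻¹ := Finset.prod_nonneg fun k _ => (inv_pos.2 (ha k)).le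
    gcongr
    linarith
  · have := congrArg re (hmom n)
    rw [← reCLM_apply, ← reCLM.integral_comp_comm (hki n)] at this
    simpa only [reCLM_apply, hre, zero_re] using this
  · have h1 : ∀ᶠ x in 𝓝 (0 : ℝ), 0 < (ψ x).re :=
      (continuous_re.comp ψ.continuous).continuousAt.eventually_const_lt hψ0
    have h2 : ∀ᶠ x in 𝓝 (0 : ℝ), 0 < 1 - (∑' k, a k) * |x| :=
      (by fun_prop : Continuous fun x : ℝ => 1 - (∑' k, a k) * |x|).continuousAt.eventually_const_lt
        (by simp)
    filter_upwards [h1, h2] with x hx1 hx2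
    exact mul_pos (hx2.trans_le (hH1 x)) hx1

/-- Integration against the positive part of a density. -/
lemma integrable_withDensity_ofReal {g φ : ℝ → ℝ} (hg : Measurable g) (hφ : Measurable φ)
    (h : Integrable fun x => |φ x| * |g x|) :
    Integrable φ (volume.withDensity fun x => ENNReal.ofReal (g x)) := by
  rw [integrable_withDensity_iff_integrable_smul' hg.ennreal_ofReal (by simp)]
  refine h.mono' (by fun_prop) (.of_forall fun x => ?_)
  rw [norm_smul, ENNReal.toReal_ofReal', Real.norm_of_nonneg (le_max_right _ _), Real.norm_eq_abs,
    mul_comm]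
  exact mul_le_mul_of_nonneg_left (max_le (le_abs_self _) (abs_nonneg _)) (abs_nonneg _)

lemma integral_withDensity_ofReal {g : ℝ → ℝ} (hg : Measurable g) (φ : ℝ → ℝ) :
    ∫ x, φ x ∂(volume.withDensity fun x => ENNReal.ofReal (g x)) = ∫ x, φ x * max (g x) 0 := by
  rw [integral_withDensity_eq_integral_toReal_smul hg.ennreal_ofReal (by simp)]
  simp only [ENNReal.toReal_ofReal', smul_eq_mul, mul_comm]

/-- Indeterminacy on the line when Carleman's condition fails. -/
theorem exists_measure_ne_of_summable {M : ℕ → ℝ} (hpos : ∀ n, 0 < M n) (hM0 : M 0 = 1)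
    (hS : Summable fun n => M n / M (n + 1)) :
    ∃ μ ν : Measure ℝ, IsFiniteMeasure μ ∧ IsFiniteMeasure ν ∧
      (∀ n : ℕ, Integrable (fun x => |x| ^ n) μ) ∧ (∀ n : ℕ, Integrable (fun x => |x| ^ n) ν) ∧
      (∀ n : ℕ, ∫ x, x ^ n ∂μ = ∫ x, x ^ n ∂ν) ∧
      (∃ c : ℝ, 0 < c ∧ ∀ n : ℕ, ∫ x, |x| ^ n ∂μ ≤ c * M n ∧ ∫ x, |x| ^ n ∂ν ≤ c * M n) ∧
      μ ≠ ν := by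
  obtain ⟨g, c, hgm, hc, hgi, hgb, hg0, hgpos⟩ :=
    exists_density (fun n => div_pos (hpos n) (hpos (n + 1))) hS
  -- With `a k = M k / M (k + 1)` the decay constants telescope to `M n / M 0 = M n`.
  have hprod : ∀ n, ∏ k ∈ Finset.range n, (M k / M (k + 1))⁻¹ = M n := by
    intro n
    induction n with
    | zero => simp [hM0]
    | succ n ih => rw [Finset.prod_range_succ, ih, inv_div, mul_div_cancel₀ _ (hpos n).ne']
  simp only [hprod] at hgb
  have key : ∀ f : ℝ → ℝ, Measurable f → (∀ x, |f x| = |g x|) →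
      (∀ n : ℕ, Integrable (fun x => |x| ^ n) (volume.withDensity fun x => ENNReal.ofReal (f x))) ∧
      ∀ n : ℕ, ∫ x, |x| ^ n ∂(volume.withDensity fun x => ENNReal.ofReal (f x)) ≤ c * M n := by
    intro f hf hfg
    have hi : ∀ n : ℕ,
        Integrable (fun x => |x| ^ n) (volume.withDensity fun x => ENNReal.ofReal (f x)) := fun n =>
      integrable_withDensity_ofReal hf (by fun_prop) (by simpa [hfg] using hgi n)
    refine ⟨hi, fun n => le_trans ?_ (hgb n)⟩
    rw [integral_withDensity_ofReal hf]
    refine integral_mono_of_nonneg (.of_forall fun x => by positivity) (hgi n)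
      (.of_forall fun x => ?_)
    simp only [← hfg]
    exact mul_le_mul_of_nonneg_left (max_le (le_abs_self _) (abs_nonneg _)) (by positivity)
  have fin : ∀ {μ : Measure ℝ}, (∀ n : ℕ, Integrable (fun x => |x| ^ n) μ) → IsFiniteMeasure μ := by
    intro μ h
    have := h 0
    simp only [pow_zero] at this
    exact (integrable_const_iff_isFiniteMeasure one_ne_zero).1 this
  obtain ⟨h1, h2⟩ := key g hgm fun _ => rfl
  obtain ⟨h3, h4⟩ := key (fun x => -g x) hgm.neg fun _ => abs_neg _
  refine ⟨_, _, fin h1, fin h3, h1, h3, fun n => ?_, ⟨c, hc, fun n => ⟨h2 n, h4 n⟩⟩, fun h => ?_⟩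
  · rw [integral_withDensity_ofReal hgm, integral_withDensity_ofReal (g := fun x => -g x) hgm.neg,
      ← sub_eq_zero, ← integral_sub]
    · refine (integral_congr_ae (.of_forall fun x => ?_)).trans (hg0 n)
      rw [← mul_sub]
      congr 1
      exact max_zero_sub_eq_self (g x)
    all_goals
      refine (hgi n).mono' (by fun_prop) (.of_forall fun x => ?_)
      rw [norm_mul, norm_pow, Real.norm_of_nonneg (le_max_right _ _), Real.norm_eq_abs]
      refine mul_le_mul_of_nonneg_left (max_le ?_ (abs_nonneg _)) (by positivity)
      first | exact le_abs_self _ | exact neg_le_abs _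
  -- Near `0` the density `g` is positive, so the negative part gives no mass to a small ball while
  -- the positive part does.
  · obtain ⟨ε, hε, hb⟩ := Metric.eventually_nhds_iff_ball.1 hgpos
    have hm : MeasurableSet (Metric.ball (0 : ℝ) ε) := Metric.isOpen_ball.measurableSet
    have h5 := congrArg (fun μ => μ (Metric.ball (0 : ℝ) ε)) h
    simp only [withDensity_apply _ hm] at h5
    rw [setLIntegral_congr_fun hm (g := fun _ => 0)
      (fun x hx => ENNReal.ofReal_of_nonpos (neg_nonpos.2 (hb x hx).le)) (f := fun x =>
        ENNReal.ofReal (-g x)), lintegral_zero, setLIntegral_eq_zero_iff hm hgm.ennreal_ofReal] at h5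
    have h6 : volume (Metric.ball (0 : ℝ) ε) = 0 := by
      refine measure_mono_null (fun x hx => ?_) (ae_iff.1 h5)
      simpa using ⟨by simpa using hx, hb x hx⟩
    simp [Real.volume_ball, hε.not_ge] at h6

end MomentProblem

/-! ### Odd moments, and passage between the line and `ℝ^d` -/

namespace MomentProblem

variable {d : ℕ}

lemma prod_apply_eq_monomial {n : ℕ} (p : Fin n → Fin d) (x : EuclideanSpace ℝ (Fin d)) :
    ∏ i, x (p i) = monomial (fun j => (Finset.univ.filter fun i => p i = j).card) x := by
  rw [monomial, ← Finset.prod_fiberwise Finset.univ p fun i => x (p i)]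
  refine Finset.prod_congr rfl fun j _ => ?_
  rw [Finset.prod_congr rfl fun i hi => by rw [(Finset.mem_filter.1 hi).2], Finset.prod_const]

/-- Summing over words `p` rather than multi-indices avoids multinomial coefficients. -/
lemma inner_pow_eq_sum_monomial (n : ℕ) (x u : EuclideanSpace ℝ (Fin d)) :
    inner ℝ x u ^ n = ∑ p : Fin n → Fin d, (∏ i, u (p i)) *
      monomial (fun j => (Finset.univ.filter fun i => p i = j).card) x := by
  simp only [PiLp.inner_apply, RCLike.inner_apply, conj_trivial, Fintype.sum_pow,
    Finset.prod_mul_distrib, prod_apply_eq_monomial _ x]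

lemma norm_pow_two_mul_eq_sum_monomial (n : ℕ) (x : EuclideanSpace ℝ (Fin d)) :
    ‖x‖ ^ (2 * n) = ∑ p : Fin n → Fin d,
      monomial (fun j => 2 * (Finset.univ.filter fun i => p i = j).card) x := by
  rw [pow_mul, EuclideanSpace.real_norm_sq_eq, Fintype.sum_pow]
  refine Finset.sum_congr rfl fun p _ => ?_
  rw [Finset.prod_pow, prod_apply_eq_monomial, monomial, monomial, ← Finset.prod_pow]
  simp only [← pow_mul, mul_comm]

lemma isFiniteMeasure_of_mem {μ : Measure (EuclideanSpace ℝ (Fin d))}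
    (hμ : μ ∈ finiteMomentMeasures d) : IsFiniteMeasure μ := by
  have := hμ 0
  have h1 : monomial (0 : Fin d → ℕ) = fun _ => 1 := by ext x; simp [monomial]
  rw [h1] at this
  exact (integrable_const_iff_isFiniteMeasure one_ne_zero).1 this

lemma integrable_norm_pow_of_mem {μ : Measure (EuclideanSpace ℝ (Fin d))}
    (hμ : μ ∈ finiteMomentMeasures d) (n : ℕ) : Integrable (fun x => ‖x‖ ^ n) μ := by
  have := isFiniteMeasure_of_mem hμ
  have h2 : Integrable (fun x => ‖x‖ ^ (2 * n)) μ := by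
    simp only [norm_pow_two_mul_eq_sum_monomial]
    exact integrable_finsetSum _ fun p _ => hμ _
  refine ((integrable_const (1 : ℝ)).add h2).mono' (by fun_prop) (.of_forall fun x => ?_)
  simp only [norm_pow, norm_norm, Pi.add_apply]
  rw [mul_comm, pow_mul]
  nlinarith [sq_nonneg (‖x‖ ^ n - 1)]

lemma integral_inner_pow_eq {μ ν : Measure (EuclideanSpace ℝ (Fin d))}
    (hμ : μ ∈ finiteMomentMeasures d) (hν : ν ∈ finiteMomentMeasures d)
    (h : ∀ α : Fin d → ℕ, moment μ α = moment ν α) (u : EuclideanSpace ℝ (Fin d)) (n : ℕ) :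
    ∫ x, inner ℝ x u ^ n ∂μ = ∫ x, inner ℝ x u ^ n ∂ν := by
  simp only [inner_pow_eq_sum_monomial]
  rw [integral_finsetSum _ fun p _ => (hμ _).const_mul _,
    integral_finsetSum _ fun p _ => (hν _).const_mul _]
  refine Finset.sum_congr rfl fun p _ => ?_
  rw [integral_const_mul, integral_const_mul]
  exact congrArg _ (h _)

lemma LogConvex.monotone_ratio {M : ℕ → ℝ} (hpos : ∀ n, 0 < M n) (hlog : LogConvex M) :
    Monotone fun n => M (n + 1) / M n := by
  refine monotone_nat_of_le_succ fun n => ?_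
  rw [div_le_div_iff₀ (hpos _) (hpos _), ← sq, mul_comm]
  exact hlog (n + 1) (by omega)

/-- A majorant of the absolute moments of a measure whose moments of even order `2 * k` are bounded
by `M (2 * k)`. -/
noncomputable def evenMajorant (M : ℕ → ℝ) (n : ℕ) : ℝ :=
  if Even n then M n else M (n + 1) / M n * M (n - 1)

lemma evenMajorant_two_mul (M : ℕ → ℝ) (k : ℕ) : evenMajorant M (2 * k) = M (2 * k) := by
  simp [evenMajorant]

lemma evenMajorant_two_mul_add_one (M : ℕ → ℝ) (k : ℕ) :
    evenMajorant M (2 * k + 1) = M (2 * k + 2) / M (2 * k + 1) * M (2 * k) := by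
  simp [evenMajorant]

lemma isQuasiAnalytic_evenMajorant {M : ℕ → ℝ} (hpos : ∀ n, 0 < M n) (hlog : LogConvex M)
    (hS : ¬ Summable fun n => M n / M (n + 1)) : IsQuasiAnalytic (evenMajorant M) := by
  have hmono := hlog.monotone_ratio hpos
  have hL : ∀ n, 0 < M (n + 1) / M n := fun n => div_pos (hpos _) (hpos _)
  refine isQuasiAnalytic_of_not_summable
    -- With `r n = M (n + 1) / M n`, the successive ratios of `evenMajorant M` are `r (2k+1)` from
    -- `2k` to `2k+1` and `r (2k)` from `2k+1` to `2k+2`. Both are at most `r (2k+1)`, a monotone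
    -- choice.
    (L := fun n => M (2 * (n / 2) + 1 + 1) / M (2 * (n / 2) + 1)) (fun n => hL _)
    (fun m n hmn => hmono (by omega)) (fun n => ?_) (fun n => ?_) fun h => hS ?_
  · obtain ⟨k, rfl | rfl⟩ := n.even_or_odd'
    · rw [evenMajorant_two_mul, evenMajorant_two_mul_add_one, Nat.mul_div_cancel_left _ two_pos]
    · rw [show 2 * k + 1 + 1 = 2 * (k + 1) by ring, evenMajorant_two_mul,
        evenMajorant_two_mul_add_one, show (2 * k + 1) / 2 = k by omega]
      have h1 := hlog (2 * k + 1) (by omega)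
      have h2 := hpos (2 * k + 1)
      have h3 := hpos (2 * k + 2)
      change M (2 * k + 2) ≤ M (2 * k + 2) / M (2 * k + 1) * _
      have e : M (2 * k + 2) / M (2 * k + 1) * (M (2 * k + 2) / M (2 * k + 1) * M (2 * k)) =
          M (2 * k + 2) * (M (2 * k) * M (2 * k + 2)) / M (2 * k + 1) ^ 2 := by
        field_simp
      rw [e, le_div_iff₀ (by positivity)]
      exact mul_le_mul_of_nonneg_left h1 h3.le
  · unfold evenMajorant
    split_ifs
    · exact (hpos n).le
    · exact (mul_pos (hL n) (hpos _)).le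
  -- Since `2 * (n / 2) + 1 ≤ n + 1`, the inverse bounds dominate the original series shifted by
  -- one.
  · rw [← summable_nat_add_iff 1]
    refine h.of_nonneg_of_le (fun n => (div_pos (hpos _) (hpos _)).le) fun n => ?_
    rw [← inv_div]
    exact inv_anti₀ (hL _) (hmono (by omega))

/-- For odd order, weighted AM–GM `t ≤ l / 2 + t ^ 2 / (2 * l)` with `l = M (2k+2) / M (2k+1)` turns
the upper even moment into `M (2k+1) / 2`, and log-convexity gives `M (2k+1) ≤ l * M (2k)`. -/
lemma integral_norm_pow_le_evenMajorant {M : ℕ → ℝ} (hpos : ∀ n, 0 < M n) (hlog : LogConvex M)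
    {μ : Measure (EuclideanSpace ℝ (Fin d))} (hμ : μ ∈ finiteMomentMeasures d) {c : ℝ}
    (hc : 0 ≤ c) (h : ∀ k, ∫ x, ‖x‖ ^ (2 * k) ∂μ ≤ c * M (2 * k)) (n : ℕ) :
    ∫ x, ‖x‖ ^ n ∂μ ≤ c * evenMajorant M n := by
  obtain ⟨k, rfl | rfl⟩ := n.even_or_odd'
  · rw [evenMajorant_two_mul]
    exact h k
  · have hi := integrable_norm_pow_of_mem hμ
    set l := M (2 * k + 2) / M (2 * k + 1) with hl
    have hl0 : 0 < l := div_pos (hpos _) (hpos _)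
    have h1 : ∫ x, ‖x‖ ^ (2 * k + 1) ∂μ ≤
        ∫ x, (l / 2 * ‖x‖ ^ (2 * k) + l⁻¹ / 2 * ‖x‖ ^ (2 * (k + 1))) ∂μ := by
      refine integral_mono (hi _) (((hi _).const_mul _).add ((hi _).const_mul _)) fun x => ?_
      have e : l / 2 * ‖x‖ ^ (2 * k) + l⁻¹ / 2 * ‖x‖ ^ (2 * (k + 1)) - ‖x‖ ^ (2 * k + 1) =
          ‖x‖ ^ (2 * k) * (l⁻¹ / 2) * (l - ‖x‖) ^ 2 := by
        field_simp
        ring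
      have : 0 ≤ ‖x‖ ^ (2 * k) * (l⁻¹ / 2) * (l - ‖x‖) ^ 2 := by positivity
      simp only
      linarith
    rw [integral_add ((hi _).const_mul _) ((hi _).const_mul _), integral_const_mul,
      integral_const_mul] at h1
    rw [evenMajorant_two_mul_add_one, ← hl]
    have h2 : l⁻¹ * M (2 * (k + 1)) ≤ l * M (2 * k) := by
      have h3 := hlog (2 * k + 1) (by omega)
      simp only [Nat.add_sub_cancel] at h3
      have e : l⁻¹ * M (2 * (k + 1)) = M (2 * k + 1) := by
        rw [hl, inv_div]
        exact div_mul_cancel₀ _ (hpos (2 * k + 2)).ne'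
      rw [e, hl, div_mul_eq_mul_div, le_div_iff₀ (hpos _)]
      linarith
    have h4 : l / 2 * ∫ x, ‖x‖ ^ (2 * k) ∂μ ≤ l / 2 * (c * M (2 * k)) :=
      mul_le_mul_of_nonneg_left (h k) (by positivity)
    have h5 : l⁻¹ / 2 * ∫ x, ‖x‖ ^ (2 * (k + 1)) ∂μ ≤ l⁻¹ / 2 * (c * M (2 * (k + 1))) :=
      mul_le_mul_of_nonneg_left (h (k + 1)) (by positivity)
    have h6 := mul_le_mul_of_nonneg_left h2 hc
    linarith

/-- Determinacy on `ℝ^d` in a quasi-analytic class, by reduction to one-dimensional projections. -/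
theorem eq_of_moment_eq_of_isQuasiAnalytic {N : ℕ → ℝ} (hQ : IsQuasiAnalytic N)
    {μ ν : Measure (EuclideanSpace ℝ (Fin d))} (hμ : μ ∈ finiteMomentMeasures d)
    (hν : ν ∈ finiteMomentMeasures d) (heq : ∀ α : Fin d → ℕ, moment μ α = moment ν α) {c : ℝ}
    (hc : 0 < c) (hμN : ∀ n : ℕ, ∫ x, ‖x‖ ^ n ∂μ ≤ c * N n)
    (hνN : ∀ n : ℕ, ∫ x, ‖x‖ ^ n ∂ν ≤ c * N n) : μ = ν := by
  have := isFiniteMeasure_of_mem hμ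
  have := isFiniteMeasure_of_mem hν
  refine Measure.ext_of_charFun (funext fun u => ?_)
  have hm : Measurable fun x : EuclideanSpace ℝ (Fin d) => inner ℝ x u := by fun_prop
  -- The constant `‖u‖ + 1` stays positive when `u = 0`, as the geometric factor `B` of the class
  -- requires.
  have hle : ∀ n (x : EuclideanSpace ℝ (Fin d)), |inner ℝ x u| ^ n ≤ (‖u‖ + 1) ^ n * ‖x‖ ^ n := by
    intro n x
    rw [← mul_pow]
    refine pow_le_pow_left₀ (abs_nonneg _) ((abs_real_inner_le_norm x u).trans ?_) n
    nlinarith [norm_nonneg x]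
  have key : ∀ ρ ∈ finiteMomentMeasures d, (∀ n : ℕ, ∫ x, ‖x‖ ^ n ∂ρ ≤ c * N n) →
      (∀ n : ℕ, Integrable (fun y => |y| ^ n) (ρ.map fun x => inner ℝ x u)) ∧
      ∀ n : ℕ, ∫ y, |y| ^ n ∂(ρ.map fun x => inner ℝ x u) ≤ c * (‖u‖ + 1) ^ n * N n := by
    intro ρ hρ hρN
    have hi : ∀ n : ℕ, Integrable (fun x => |inner ℝ x u| ^ n) ρ := fun n =>
      ((integrable_norm_pow_of_mem hρ n).const_mul ((‖u‖ + 1) ^ n)).mono' (by fun_prop)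
        (.of_forall fun x => by
          rw [norm_pow, Real.norm_eq_abs, abs_abs]
          exact hle n x)
    refine ⟨fun n => ?_, fun n => ?_⟩
    · rw [integrable_map_measure (by fun_prop) hm.aemeasurable]
      exact hi n
    · rw [integral_map hm.aemeasurable (by fun_prop)]
      calc ∫ x, |inner ℝ x u| ^ n ∂ρ ≤ ∫ x, (‖u‖ + 1) ^ n * ‖x‖ ^ n ∂ρ :=
            integral_mono (hi n) ((integrable_norm_pow_of_mem hρ n).const_mul _) (hle n)
        _ = (‖u‖ + 1) ^ n * ∫ x, ‖x‖ ^ n ∂ρ := integral_const_mul _ _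
        _ ≤ (‖u‖ + 1) ^ n * (c * N n) := by gcongr; exact hρN n
        _ = _ := by ring
  obtain ⟨hμi, hμb⟩ := key μ hμ hμN
  obtain ⟨hνi, hνb⟩ := key ν hν hνN
  have h := eq_of_moments_eq_of_isQuasiAnalytic hQ hμi hνi (fun n => by
    rw [integral_map hm.aemeasurable (by fun_prop), integral_map hm.aemeasurable (by fun_prop)]
    exact integral_inner_pow_eq hμ hν heq u n) hc (by positivity) hμb hνb
  have hcf : ∀ ρ : Measure (EuclideanSpace ℝ (Fin d)),
      charFun ρ u = charFun (ρ.map fun x => inner ℝ x u) 1 := by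
    intro ρ
    rw [charFun_apply, charFun_apply_real, integral_map hm.aemeasurable (by fun_prop)]
    simp
  rw [hcf, hcf, h]

lemma monomial_single (i : Fin d) (α : Fin d → ℕ) (y : ℝ) :
    monomial α (EuclideanSpace.single i y) = y ^ α i * ∏ j ∈ Finset.univ.erase i, 0 ^ α j := by
  rw [monomial, ← Finset.mul_prod_erase _ _ (Finset.mem_univ i)]
  congr 1
  · simp
  · refine Finset.prod_congr rfl fun j hj => ?_
    simp [(Finset.mem_erase.1 hj).1]

lemma measurable_single (i : Fin d) :
    Measurable fun y : ℝ => EuclideanSpace.single i y :=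
  (Isometry.of_dist_eq fun a b => by simp).continuous.measurable

lemma map_single_mem_finiteMomentMeasures (i : Fin d) {μ : Measure ℝ}
    (hμ : ∀ n : ℕ, Integrable (fun x => |x| ^ n) μ) :
    μ.map (fun y => EuclideanSpace.single i y) ∈ finiteMomentMeasures d := by
  intro α
  have hα : Measurable (monomial α) := by unfold monomial; fun_prop
  rw [integrable_map_measure hα.aestronglyMeasurable (measurable_single i).aemeasurable]
  simp only [Function.comp_def, monomial_single]
  exact Integrable.mul_const ((hμ (α i)).mono' (by fun_prop) (.of_forall fun x => by simp)) _

lemma moment_map_single (i : Fin d) (μ : Measure ℝ) (α : Fin d → ℕ) :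
    moment (μ.map fun y => EuclideanSpace.single i y) α =
      (∫ x, x ^ α i ∂μ) * ∏ j ∈ Finset.univ.erase i, 0 ^ α j := by
  have hα : Measurable (monomial α) := by unfold monomial; fun_prop
  rw [moment, integral_map (measurable_single i).aemeasurable hα.aestronglyMeasurable]
  simp only [monomial_single]
  exact integral_mul_const _ _

lemma integral_norm_pow_map_single (i : Fin d) (μ : Measure ℝ) (n : ℕ) :
    ∫ x, ‖x‖ ^ n ∂(μ.map fun y => EuclideanSpace.single i y) = ∫ x, |x| ^ n ∂μ := by
  rw [integral_map (measurable_single i).aemeasurable (by fun_prop)]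
  simp

lemma map_single_injective (i : Fin d) {μ ν : Measure ℝ}
    (h : μ.map (fun y => EuclideanSpace.single i y) = ν.map fun y => EuclideanSpace.single i y) :
    μ = ν := by
  have key : ∀ ρ : Measure ℝ,
      (ρ.map fun y => EuclideanSpace.single i y).map (fun x => x i) = ρ := by
    intro ρ
    rw [Measure.map_map (by fun_prop) (measurable_single i)]
    convert Measure.map_id
    ext y
    simp
  rw [← key μ, h, key]

end MomentProblem

/-! ### The equivalence -/

theorem mainTheorem8 (d : ℕ) (hd : 1 ≤ d) (M : ℕ → ℝ) (hpos : ∀ n, 0 < M n)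
    (hlog : MomentProblem.LogConvex M) (hM0 : M 0 = 1) :
    MomentProblem.IsQuasiAnalytic M ↔
      ∀ μ ∈ MomentProblem.finiteMomentMeasures d, ∀ ν ∈ MomentProblem.finiteMomentMeasures d,
        (∀ α : Fin d → ℕ, MomentProblem.moment μ α = MomentProblem.moment ν α) →
        (∃ c : ℝ, 0 < c ∧ ∀ n : ℕ, 1 ≤ n →
          max (∫ x, ‖x‖ ^ (2 * n) ∂μ) (∫ x, ‖x‖ ^ (2 * n) ∂ν) ≤ c * M (2 * n)) →
        μ = ν := by
  constructor
  · rintro hQ μ hμ ν hν heq ⟨c, hc, hb⟩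
    have hS : ¬ Summable fun n => M n / M (n + 1) := by
      intro hS
      obtain ⟨μ', ν', _, _, hi, hi', hm, ⟨c', hc', hb'⟩, hne⟩ :=
        MomentProblem.exists_measure_ne_of_summable hpos hM0 hS
      exact hne (MomentProblem.eq_of_moments_eq_of_isQuasiAnalytic hQ hi hi' hm hc' one_pos
        (fun n => by simpa using (hb' n).1) fun n => by simpa using (hb' n).2)
    -- Adding the total masses covers order `0`, where the hypothesis says nothing and `M 0 = 1`.
    have hc2 : 0 < c + μ.real Set.univ + ν.real Set.univ := by positivity
    have key : ∀ ρ, ρ = μ ∨ ρ = ν → ∀ k, ∫ x, ‖x‖ ^ (2 * k) ∂ρ ≤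
        (c + μ.real Set.univ + ν.real Set.univ) * M (2 * k) := by
      intro ρ hρ k
      have h1 : 0 ≤ μ.real Set.univ := measureReal_nonneg
      have h2 : 0 ≤ ν.real Set.univ := measureReal_nonneg
      rcases Nat.eq_zero_or_pos k with rfl | hk
      · rcases hρ with rfl | rfl <;> simp [hM0] <;> linarith
      · have h3 : ∫ x, ‖x‖ ^ (2 * k) ∂ρ ≤ c * M (2 * k) := by
          rcases hρ with rfl | rfl
          · exact (le_max_left _ _).trans (hb k hk)
          · exact (le_max_right _ _).trans (hb k hk)
        refine h3.trans (mul_le_mul_of_nonneg_right (by linarith) (hpos _).le)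
    exact MomentProblem.eq_of_moment_eq_of_isQuasiAnalytic
      (MomentProblem.isQuasiAnalytic_evenMajorant hpos hlog hS) hμ hν heq hc2
      (MomentProblem.integral_norm_pow_le_evenMajorant hpos hlog hμ hc2.le (key μ (.inl rfl)))
      (MomentProblem.integral_norm_pow_le_evenMajorant hpos hlog hν hc2.le (key ν (.inr rfl)))
  · intro h
    by_contra hQ
    have hS : Summable fun n => M n / M (n + 1) := by
      by_contra hS
      refine hQ (MomentProblem.isQuasiAnalytic_of_not_summable
        (fun n => div_pos (hpos (n + 1)) (hpos n)) (hlog.monotone_ratio hpos)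
        (fun n => (div_mul_cancel₀ _ (hpos n).ne').ge) (fun n => (hpos n).le) ?_)
      simpa only [inv_div] using hS
    obtain ⟨μ, ν, _, _, hi, hi', hm, ⟨c, hc, hb⟩, hne⟩ :=
      MomentProblem.exists_measure_ne_of_summable hpos hM0 hS
    let i : Fin d := ⟨0, hd⟩
    refine hne (MomentProblem.map_single_injective i (h _
      (MomentProblem.map_single_mem_finiteMomentMeasures i hi) _
      (MomentProblem.map_single_mem_finiteMomentMeasures i hi') (fun α => ?_) ⟨c, hc, fun n _ => ?_⟩))
    · rw [MomentProblem.moment_map_single, MomentProblem.moment_map_single, hm]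
    · rw [MomentProblem.integral_norm_pow_map_single, MomentProblem.integral_norm_pow_map_single]
      exact max_le (hb _).1 (hb _).2
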